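/- **Corollary 4.3 (Bass conjecture reduction).** For a group $G$ let $\mathbb{Z}G$ be its integral group ring, let $K_0(\mathbb{Z}G)$ be the Grothendieck group of isomorphism classes of finitely generated projective $\mathbb{Z}G$-modules under direct sum, and let $HH_0(\mathbb{Z}G)=\mathbb{Z}G/[\mathbb{Z}G,\mathbb{Z}G]$, where $[\mathbb{Z}G,\mathbb{Z}G]$ is the additive subgroup generated by the elements $gh-hg$ ($g,h\in G$); thus $HH_0(\mathbb{Z}G)=\bigoplus_{[s]}\mathbb{Z}\cdot[s]$, the sum being over the conjugacy classes $[s]$ of $G$. The Hattori–Stallings trace is the homomorphism $\mathrm{HS}_G\colon K_0(\mathbb{Z}G)\to HH_0(\mathbb{Z}G)$ that sends the class of a finitely generated projective module to the class in $HH_0(\mathbb{Z}G)$ of the trace of any idempotent matrix over $\mathbb{Z}G$ determining that module. The Bass trace conjecture holds for $G$ if the image of $\mathrm{HS}_G$ is contained in $\mathbb{Z}\cdot[e]$, where $e$ is the identity element of $G$. A nontrivial group $G$ is called binate if for every finitely generated subgroup $H\le G$ there are a homomorphism $\varphi\colon H\to G$ and an element $u\in G$ such that $h=[u,\varphi(h)]=u\,\varphi(h)\,u^{-1}\varphi(h)^{-1}$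 for all $h\in H$. Then the Bass trace conjecture holds for all groups if and only if it holds for all binate groups. -/

import Mathlib

universe u v w

/-- A nontrivial group `G` is *binate* if for every finitely generated subgroup `H` of `G` there are
a homomorphism `φ : H → G` and an element `s` of `G` with `h = [s, φ h] = s (φ h) s⁻¹ (φ h)⁻¹`
for all `h ∈ H`. -/
def IsBinate (G : Type u) [Group G] : Prop :=
  Nontrivial G ∧ ∀ H : Subgroup G, H.FG →
    ∃ (φ : H →* G) (s : G), ∀ h : H, (h : G) = s * φ h * s⁻¹ * (φ h)⁻¹

section HochschildZero

/-- The additive subgroup `[R, R]` of a ring `R` generated by the additive commutators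
`a b - b a`.  (For a group ring `ℤG` this is, by biadditivity, the additive subgroup generated by
the elements `g h - h g` with `g, h ∈ G`.) -/
def ringCommutator (R : Type u) [Ring R] : AddSubgroup R :=
  AddSubgroup.closure {x | ∃ a b : R, x = a * b - b * a}

/-- `HH₀(R) = R / [R, R]`. -/
abbrev HHZero (R : Type u) [Ring R] : Type u := R ⧸ ringCommutator R

/-- The universal trace `R → R / [R, R]`. -/
def HHZero.mk (R : Type u) [Ring R] : R →+ HHZero R := QuotientAddGroup.mk' (ringCommutator R)

theorem HHZero.mk_mul_comm {R : Type u} [Ring R] (a b : R) :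
    HHZero.mk R (a * b) = HHZero.mk R (b * a) := by
  rw [← sub_eq_zero, ← map_sub]
  exact (QuotientAddGroup.eq_zero_iff _).2 (AddSubgroup.subset_closure ⟨a, b, rfl⟩)

end HochschildZero

section HattoriStallings

/-- A finite dual basis (coordinate system) of a left `R`-module `P`: elements `x i` and
functionals `f i` with `p = ∑ i, f i p • x i` for all `p`.  The matrix `(f j (x i))` is then
an idempotent matrix over `R` whose row space is isomorphic to `P`, and its trace is
`∑ i, f i (x i)`. -/
def IsDualBasis {R : Type u} [Ring R] {P : Type v} [AddCommGroup P] [Module R P]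
    {ι : Type w} [Fintype ι] (x : ι → P) (f : ι → P →ₗ[R] R) : Prop :=
  ∀ p : P, ∑ i, f i p • x i = p

theorem exists_isDualBasis (R : Type u) [Ring R] (P : Type v) [AddCommGroup P] [Module R P]
    [Module.Finite R P] [Module.Projective R P] :
    ∃ (n : ℕ) (x : Fin n → P) (f : Fin n → P →ₗ[R] R), IsDualBasis x f := by
  obtain ⟨n, a, b, -, -, h⟩ := Module.Finite.exists_comp_eq_id_of_projective R P
  refine ⟨n, fun i => a (Pi.single i 1), fun i => (LinearMap.proj i).comp b, fun p => ?_⟩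
  have h1 : a (b p) = p := LinearMap.congr_fun h p
  have h2 : b p = ∑ i, b p i • (Pi.single i (1 : R) : Fin n → R) := by
    ext j
    simp [Finset.sum_apply, Pi.single_apply]
  conv_rhs => rw [← h1, h2, map_sum]
  simp

/-- The trace of the idempotent matrix of a dual basis, taken in `R / [R, R]`, does not depend on
the dual basis, nor on the module up to isomorphism. -/
theorem IsDualBasis.trace_eq {R : Type u} [Ring R] {P : Type v} [AddCommGroup P] [Module R P]
    {Q : Type v} [AddCommGroup Q] [Module R Q] (e : P ≃ₗ[R] Q)
    {ι κ : Type*} [Fintype ι] [Fintype κ]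
    {x : ι → P} {f : ι → P →ₗ[R] R} (hx : IsDualBasis x f)
    {y : κ → Q} {g : κ → Q →ₗ[R] R} (hy : IsDualBasis y g) :
    HHZero.mk R (∑ i, f i (x i)) = HHZero.mk R (∑ j, g j (y j)) := by
  have h1 : ∀ i, f i (x i) = ∑ j, g j (e (x i)) * f i (e.symm (y j)) := fun i => by
    have h := congrArg (fun q => f i (e.symm q)) (hy (e (x i)))
    simpa using h.symm
  have h2 : ∀ j, g j (y j) = ∑ i, f i (e.symm (y j)) * g j (e (x i)) := fun j => by
    have h := congrArg (fun p => g j (e p)) (hx (e.symm (y j)))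
    simpa using h.symm
  simp only [h1, h2, map_sum]
  rw [Finset.sum_comm]
  exact Finset.sum_congr rfl fun j _ => Finset.sum_congr rfl fun i _ => HHZero.mk_mul_comm _ _

/-- The Hattori-Stallings trace (rank) of a finitely generated projective left `R`-module `P`:
the class in `R / [R, R]` of the trace of an idempotent matrix that determines `P`. -/
noncomputable def hattoriStallingsRank (R : Type u) [Ring R] (P : Type v) [AddCommGroup P]
    [Module R P] [Module.Finite R P] [Module.Projective R P] : HHZero R :=
  HHZero.mk R (∑ i, (exists_isDualBasis R P).choose_spec.choose_spec.choose i
    ((exists_isDualBasis R P).choose_spec.choose i))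

theorem hattoriStallingsRank_eq {R : Type u} [Ring R] {P : Type v} [AddCommGroup P] [Module R P]
    [Module.Finite R P] [Module.Projective R P] {ι : Type*} [Fintype ι]
    {x : ι → P} {f : ι → P →ₗ[R] R} (hx : IsDualBasis x f) :
    hattoriStallingsRank R P = HHZero.mk R (∑ i, f i (x i)) :=
  IsDualBasis.trace_eq (LinearEquiv.refl R P)
    (exists_isDualBasis R P).choose_spec.choose_spec.choose_spec hx

theorem hattoriStallingsRank_congr {R : Type u} [Ring R]
    {P : Type v} [AddCommGroup P] [Module R P] [Module.Finite R P] [Module.Projective R P]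
    {Q : Type v} [AddCommGroup Q] [Module R Q] [Module.Finite R Q] [Module.Projective R Q]
    (e : P ≃ₗ[R] Q) : hattoriStallingsRank R P = hattoriStallingsRank R Q :=
  IsDualBasis.trace_eq e (exists_isDualBasis R P).choose_spec.choose_spec.choose_spec
    (exists_isDualBasis R Q).choose_spec.choose_spec.choose_spec

theorem hattoriStallingsRank_prod {R : Type u} [Ring R]
    {P : Type v} [AddCommGroup P] [Module R P] [Module.Finite R P] [Module.Projective R P]
    {Q : Type v} [AddCommGroup Q] [Module R Q] [Module.Finite R Q] [Module.Projective R Q] :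
    hattoriStallingsRank R (P × Q) = hattoriStallingsRank R P + hattoriStallingsRank R Q := by
  obtain ⟨m, x, f, hx⟩ := exists_isDualBasis R P
  obtain ⟨n, y, g, hy⟩ := exists_isDualBasis R Q
  have h : IsDualBasis (R := R) (P := P × Q)
      (Sum.elim (fun i => (x i, 0)) (fun j => (0, y j)))
      (Sum.elim (fun i => (f i).comp (LinearMap.fst R P Q))
        (fun j => (g j).comp (LinearMap.snd R P Q))) := fun p => by
    ext
    · simpa [Fintype.sum_sum_type, Prod.fst_sum] using hx p.1
    · simpa [Fintype.sum_sum_type, Prod.snd_sum] using hy p.2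
  rw [hattoriStallingsRank_eq h, hattoriStallingsRank_eq hx, hattoriStallingsRank_eq hy, ← map_add]
  simp [Fintype.sum_sum_type]

theorem hattoriStallingsRank_of_subsingleton {R : Type u} [Ring R]
    {P : Type v} [AddCommGroup P] [Module R P] [Module.Finite R P] [Module.Projective R P]
    [Subsingleton P] : hattoriStallingsRank R P = 0 := by
  have h : IsDualBasis (R := R) (P := P) (ι := Fin 0) Fin.elim0 Fin.elim0 :=
    fun p => Subsingleton.elim _ _
  rw [hattoriStallingsRank_eq h]
  simp

end HattoriStallings

section KZero

/-- A finitely generated projective left `R`-module. -/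
structure FGProj (R : Type u) [Ring R] : Type (u + 1) where
  carrier : Type u
  [addCommGroup : AddCommGroup carrier]
  [module : Module R carrier]
  [finite : Module.Finite R carrier]
  [projective : Module.Projective R carrier]

attribute [instance] FGProj.addCommGroup FGProj.module FGProj.finite FGProj.projective

/-- Isomorphism of finitely generated projective modules. -/
instance FGProj.isoSetoid (R : Type u) [Ring R] : Setoid (FGProj R) where
  r P Q := Nonempty (P.carrier ≃ₗ[R] Q.carrier)
  iseqv := ⟨fun _ => ⟨LinearEquiv.refl _ _⟩, fun ⟨e⟩ => ⟨e.symm⟩, fun ⟨e⟩ ⟨f⟩ => ⟨e.trans f⟩⟩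

/-- The set of isomorphism classes of finitely generated projective left `R`-modules. -/
def FGProjClass (R : Type u) [Ring R] : Type (u + 1) := Quotient (FGProj.isoSetoid R)

/-- The isomorphism class of a finitely generated projective left `R`-module. -/
def FGProjClass.mk {R : Type u} [Ring R] (P : FGProj R) : FGProjClass R :=
  Quotient.mk (FGProj.isoSetoid R) P

/-- The class of the zero module. -/
instance FGProjClass.instZero (R : Type u) [Ring R] : Zero (FGProjClass R) :=
  ⟨FGProjClass.mk ⟨PUnit.{u + 1}⟩⟩

/-- Addition of isomorphism classes is direct sum. -/
instance FGProjClass.instAdd (R : Type u) [Ring R] : Add (FGProjClass R) :=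
  ⟨Quotient.map₂ (fun P Q => ⟨P.carrier × Q.carrier⟩)
    fun _ _ ⟨e⟩ _ _ ⟨f⟩ => ⟨e.prodCongr f⟩⟩

instance FGProjClass.instAddCommMonoid (R : Type u) [Ring R] : AddCommMonoid (FGProjClass R) where
  add_assoc := by
    rintro ⟨P⟩ ⟨Q⟩ ⟨S⟩
    exact Quotient.sound ⟨LinearEquiv.prodAssoc R P.carrier Q.carrier S.carrier⟩
  zero_add := by
    rintro ⟨P⟩
    exact Quotient.sound ⟨LinearEquiv.uniqueProd⟩
  add_zero := by
    rintro ⟨P⟩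
    exact Quotient.sound ⟨LinearEquiv.prodUnique⟩
  add_comm := by
    rintro ⟨P⟩ ⟨Q⟩
    exact Quotient.sound ⟨LinearEquiv.prodComm R P.carrier Q.carrier⟩
  nsmul := nsmulRec

/-- `K₀(R)`: the Grothendieck group of the commutative monoid of isomorphism classes of finitely
generated projective left `R`-modules under direct sum. -/
abbrev KZero (R : Type u) [Ring R] : Type (u + 1) :=
  Algebra.GrothendieckAddGroup (FGProjClass R)

/-- The Hattori-Stallings trace on isomorphism classes. -/
noncomputable def hattoriStallingsClass (R : Type u) [Ring R] : FGProjClass R →+ HHZero R where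
  toFun := Quotient.lift (fun P => hattoriStallingsRank R P.carrier)
    fun _ _ ⟨e⟩ => hattoriStallingsRank_congr e
  map_zero' := hattoriStallingsRank_of_subsingleton (R := R) (P := PUnit.{u + 1})
  map_add' := by
    rintro ⟨P⟩ ⟨Q⟩
    exact hattoriStallingsRank_prod (R := R) (P := P.carrier) (Q := Q.carrier)

/-- The Hattori-Stallings trace homomorphism `HS : K₀(R) → HH₀(R)`,
`[P] - [Q] ↦ rank P - rank Q`. -/
noncomputable def hattoriStallings (R : Type u) [Ring R] : KZero R →+ HHZero R :=
  Algebra.GrothendieckAddGroup.lift (hattoriStallingsClass R)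

end KZero

/-- The Bass trace conjecture for the group `G`: the image of the Hattori-Stallings trace
`HS_G : K₀(ℤG) → HH₀(ℤG) = ⨁_{[s]} ℤ·[s]` is contained in `ℤ·[e]`. -/
def BassTraceConjecture (G : Type u) [Group G] : Prop :=
  (hattoriStallings (MonoidAlgebra ℤ G)).range ≤
    AddSubgroup.zmultiples (HHZero.mk (MonoidAlgebra ℤ G) (MonoidAlgebra.of ℤ G 1))

/-! Only the step from binate groups to all groups needs an argument. Each `G` maps to a binate
group `B` by a `j` that never fuses distinct conjugacy classes
(`exists_isBinate_isConj_reflecting`). Then `HH₀(ℤG) → HH₀(ℤB)` is injective, since `HH₀` of a group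
ring is free on the conjugacy classes (`conjClassSum_eq_iff`). An idempotent matrix over `ℤG` stays
idempotent over `ℤB`, where its trace is a multiple of `[e]`; injectivity pulls this back to `G`.

`B` is the union of the tower `D ↦ D ≀ᵣ ℤ`, with `D` embedded as the functions supported at the
identity of `ℤ`. There each `d` is the commutator of a shift with the function constant on a
half-line, which gives binateness. -/

/-! ### Embedding a group in a wreath product -/

/-- The homomorphism `D → D ≀ᵣ Q` that sends `d` to the function with value `d` on `S` and `1`
elsewhere. -/
noncomputable def RegularWreathProduct.constOn {D Q : Type*} [Group D] [Group Q] (S : Set Q) :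
    D →* D ≀ᵣ Q where
  toFun d := ⟨S.mulIndicator fun _ => d, 1⟩
  map_one' := by ext <;> simp
  map_mul' a b := by
    ext q
    · by_cases hq : q ∈ S <;> simp [hq]
    · simp

/-- If the conjugator has trivial `Q`-part, its value at `1` conjugates `x` to `y`. Otherwise it
moves the support off `1`, which forces `x = y = 1`. -/
theorem RegularWreathProduct.isConj_of_isConj_constOn_one {D Q : Type*} [Group D] [Group Q]
    {x y : D} (h : IsConj (constOn ({1} : Set Q) x) (constOn {1} y)) : IsConj x y := by
  rw [isConj_iff] at h
  obtain ⟨c, hc⟩ := h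
  have hl := congrArg RegularWreathProduct.left (mul_inv_eq_iff_eq_mul.1 hc)
  by_cases hq : c.right = 1
  · refine isConj_iff.2 ⟨c.left 1, mul_inv_eq_iff_eq_mul.2 ?_⟩
    simpa [constOn, hq] using congrFun hl 1
  · have h1 := congrFun hl 1
    have h2 := congrFun hl c.right
    simp [constOn, hq] at h1 h2
    rw [h1, h2]

theorem RegularWreathProduct.constOn_one_injective {D Q : Type*} [Group D] [Group Q] :
    Function.Injective (constOn ({1} : Set Q) : D →* D ≀ᵣ Q) := fun x y h => by
  simpa [constOn] using congrFun (congrArg RegularWreathProduct.left h) 1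

/-- Shifting by `-1` turns the indicator of `q > 0` into that of `q ≥ 0`; the quotient of the two is
supported at `0`, the point written `1` in `Multiplicative ℤ`. -/
theorem RegularWreathProduct.constOn_one_eq_commutator {D : Type*} [Group D] (d : D) :
    constOn ({1} : Set (Multiplicative ℤ)) d =
      inl (Multiplicative.ofAdd (-1)) * constOn (Set.Ioi 1) d *
        (inl (Multiplicative.ofAdd (-1)))⁻¹ * (constOn (Set.Ioi 1) d)⁻¹ := by
  rw [eq_mul_inv_iff_mul_eq, eq_mul_inv_iff_mul_eq]
  ext q
  · have hone : (q = 1) ↔ (Multiplicative.toAdd q = 0) := Iff.rfl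
    have hlt : ∀ p : Multiplicative ℤ, (1 < p) ↔ (0 < Multiplicative.toAdd p) := fun _ => Iff.rfl
    rcases lt_trichotomy (Multiplicative.toAdd q) 0 with hn | hn | hn
    · have h1 : ¬ (0 < 1 + Multiplicative.toAdd q) := by lia
      simp [constOn, Set.mulIndicator_apply, hone, hlt, hn.ne, hn.not_gt, h1,
        -Set.mulIndicator_singleton]
    · simp [constOn, Set.mulIndicator_apply, hone, hlt, hn, -Set.mulIndicator_singleton]
    · have h1 : 0 < 1 + Multiplicative.toAdd q := by lia
      simp [constOn, Set.mulIndicator_apply, hone, hlt, hn.ne', hn, h1,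
        -Set.mulIndicator_singleton]
  · simp [constOn]

/-! ### The binate envelope -/

open CategoryTheory in
/-- A sequence of injective group homomorphisms has a union. -/
theorem GrpCat.exists_sequential_union (X : ℕ → GrpCat.{u}) (f : ∀ n, X n →* X (n + 1))
    (hf : ∀ n, Function.Injective (f n)) :
    ∃ (B : GrpCat.{u}) (ι : ∀ n, X n →* B), (∀ n x, ι (n + 1) (f n x) = ι n x) ∧
      (∀ b, ∃ n x, ι n x = b) ∧ ∀ n, Function.Injective (ι n) := by
  let F : ℕ ⥤ GrpCat.{u} := Functor.ofSequence fun n => GrpCat.ofHom (f n)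
  let g : ∀ i j (_ : i ≤ j), X i →* X j := fun i j h => (F.map (homOfLE h)).hom
  have hg : ∀ i (h : i ≤ i + 1), g i (i + 1) h = f i := fun i _ =>
    congrArg GrpCat.Hom.hom (Functor.ofSequence_map_homOfLE_succ _ i)
  have : DirectedSystem (fun i => X i) (g · · ·) :=
    { map_self := fun i x => ConcreteCategory.congr_hom (F.map_id i) x
      map_map := fun _ _ _ hij hjk x =>
        (ConcreteCategory.congr_hom (F.map_comp (homOfLE hij) (homOfLE hjk)) x).symm }
  have hinj : ∀ i j hij, Function.Injective (g i j hij) := by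
    intro i j hij
    induction j, hij using Nat.le_induction with
    | base =>
      intro x y h
      rwa [DirectedSystem.map_self' g, DirectedSystem.map_self' g] at h
    | succ j hij ih =>
      intro x y h
      rw [← DirectedSystem.map_map' g hij j.le_succ, ← DirectedSystem.map_map' g hij j.le_succ,
        hg] at h
      exact ih (hf j h)
  refine ⟨GrpCat.of (DirectLimit (fun i => X i) g), fun n =>
    { toFun := fun x => (⟦⟨n, x⟩⟧ : DirectLimit (fun i => X i) g)
      map_one' := (DirectLimit.one_def n).symm
      map_mul' := fun x y => (DirectLimit.mul_def (G := fun i => X i) (f := g) n x y).symm },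
    fun n x => ?_, fun b => ?_, fun n => DirectLimit.mk_injective g hinj n⟩
  · rw [← hg n n.le_succ]
    exact DirectLimit.mk_apply (F := fun i => X i) (f := g) n (n + 1) x n.le_succ
  · obtain ⟨n, x, h⟩ := DirectLimit.exists_eq_mk g b
    exact ⟨n, x, h.symm⟩

/-- Iterated wreath products with the infinite cyclic group. -/
def wreathTower (G : GrpCat.{u}) : ℕ → GrpCat.{u}
  | 0 => G
  | n + 1 => GrpCat.of (wreathTower G n ≀ᵣ Multiplicative ℤ)

/-- Every group embeds in a binate group in such a way that elements which become conjugate were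
already conjugate. -/
theorem exists_isBinate_isConj_reflecting (G : Type u) [Group G] :
    ∃ (B : GrpCat.{u}) (j : G →* B), IsBinate B ∧ ∀ x y, IsConj (j x) (j y) → IsConj x y := by
  let X := wreathTower (GrpCat.of G)
  let f : ∀ n, X n →* X (n + 1) := fun n => RegularWreathProduct.constOn {1}
  obtain ⟨B, ι, hι, hsurj, hinj⟩ := GrpCat.exists_sequential_union X f
    fun n => RegularWreathProduct.constOn_one_injective
  have hcomm : ∀ n, ∃ (p : X n →* X (n + 1)) (s : X (n + 1)),
      ∀ d, f n d = s * p d * s⁻¹ * (p d)⁻¹ := fun n =>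
    ⟨RegularWreathProduct.constOn (Set.Ioi 1), RegularWreathProduct.inl (Multiplicative.ofAdd (-1)),
      RegularWreathProduct.constOn_one_eq_commutator⟩
  have hmono : Monotone fun n => (ι n).range := monotone_nat_of_le_succ fun n => by
    rintro _ ⟨x, rfl⟩
    exact ⟨f n x, hι n x⟩
  -- The conjugator may live `k` stages higher. Quantifying over `n` lets the induction trade one of
  -- these stages for a step up the tower.
  have hconj : ∀ k n (x y : X n), ∀ b ∈ (ι (n + k)).range, b * ι n x * b⁻¹ = ι n y →
      IsConj x y := by
    intro k
    induction k with
    | zero =>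
      rintro n x y _ ⟨c, rfl⟩ h
      exact isConj_iff.2 ⟨c, hinj n (by simpa using h)⟩
    | succ k ih =>
      intro n x y b hb h
      rw [← Nat.succ_add_eq_add_succ] at hb
      refine RegularWreathProduct.isConj_of_isConj_constOn_one (Q := Multiplicative ℤ)
        (ih (n + 1) (f n x) (f n y) b hb ?_)
      rwa [hι, hι]
  refine ⟨B, ι 0, ⟨?_, fun H hH => ?_⟩, fun x y h => ?_⟩
  -- `X 0 = G` may be trivial; `X 1` always contains a copy of `ℤ`.
  · have : Nontrivial (X 1) := ⟨⟨RegularWreathProduct.inl (Multiplicative.ofAdd 1), 1, fun h =>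
      one_ne_zero (α := ℤ) (congrArg (Multiplicative.toAdd ∘ RegularWreathProduct.right) h)⟩⟩
    exact (hinj 1).nontrivial
  -- Finitely many generators all lie in one stage, and the next stage supplies the commutators.
  · obtain ⟨n, hn⟩ : ∃ n, H ≤ (ι n).range := by
      obtain ⟨S, rfl⟩ := hH
      choose N hN using hsurj
      refine ⟨S.sup N, (Subgroup.closure_le _).2 fun b hb => ?_⟩
      exact hmono (Finset.le_sup hb) (hN b)
    let ψ : H →* X n :=
      (MonoidHom.ofInjective (hinj n)).symm.toMonoidHom.comp (Subgroup.inclusion hn)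
    have hψ : ∀ h : H, ι n (ψ h) = h := fun h =>
      congrArg Subtype.val ((MonoidHom.ofInjective (hinj n)).apply_symm_apply _)
    obtain ⟨p, s, hps⟩ := hcomm n
    refine ⟨(ι (n + 1)).comp (p.comp ψ), ι (n + 1) s, fun h => ?_⟩
    simp [← hψ h, ← hι n, hps]
  · obtain ⟨b, hb⟩ := isConj_iff.1 h
    obtain ⟨n, c, rfl⟩ := hsurj b
    exact hconj n 0 x y _ (by rw [zero_add]; exact ⟨c, rfl⟩) hb

/-! ### Traces of idempotent matrices -/

/-- The image of an idempotent matrix is a finitely generated projective module with a dual basis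
whose trace is the trace of the matrix. -/
theorem hattoriStallings_idempotent {R : Type u} [Ring R] {n : ℕ} (E : Matrix (Fin n) (Fin n) R)
    (hE : E * E = E) : HHZero.mk R E.trace ∈ (hattoriStallings R).range := by
  let L : (Fin n → R) →ₗ[R] (Fin n → R) := Matrix.toLinearMapRight' E
  have hL : ∀ v, L (L v) = L v := fun v => by
    simp [L, Matrix.vecMul_vecMul, hE]
  have hmem : ∀ p : L.range, L p = p := by
    rintro ⟨_, v, rfl⟩
    exact hL v
  have hsurj : L.rangeRestrict ∘ₗ L.range.subtype = LinearMap.id :=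
    LinearMap.ext fun p => Subtype.ext (hmem p)
  have : Module.Projective R L.range := Module.Projective.of_split _ _ hsurj
  have hdual : IsDualBasis (R := R) (P := L.range)
      (fun i => L.rangeRestrict (Pi.single i 1)) (fun i => LinearMap.proj i ∘ₗ L.range.subtype) := by
    intro p
    refine Eq.trans ?_ (LinearMap.congr_fun hsurj p)
    simp only [LinearMap.comp_apply, LinearMap.proj_apply, ← map_smul, ← map_sum]
    congr 1
    ext j
    simp [Finset.sum_apply, Pi.single_apply]
  refine ⟨Algebra.GrothendieckAddGroup.of (FGProjClass.mk ⟨L.range⟩), ?_⟩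
  have h1 : hattoriStallings R (Algebra.GrothendieckAddGroup.of (FGProjClass.mk ⟨L.range⟩)) =
      hattoriStallingsRank R L.range :=
    DFunLike.congr_fun (Algebra.GrothendieckAddGroup.lift.symm_apply_apply
      (hattoriStallingsClass R)) (FGProjClass.mk ⟨L.range⟩)
  rw [h1, hattoriStallingsRank_eq hdual]
  simp [Matrix.trace, L]

/-- Every Hattori-Stallings rank is the trace of an idempotent matrix. -/
theorem exists_idempotent_hattoriStallingsRank (R : Type u) [Ring R] (P : Type v) [AddCommGroup P]
    [Module R P] [Module.Finite R P] [Module.Projective R P] :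
    ∃ (n : ℕ) (E : Matrix (Fin n) (Fin n) R), E * E = E ∧
      hattoriStallingsRank R P = HHZero.mk R E.trace := by
  obtain ⟨n, x, f, h⟩ := exists_isDualBasis R P
  refine ⟨n, Matrix.of fun i j => f j (x i), ?_, hattoriStallingsRank_eq h⟩
  ext i j
  simpa [Matrix.mul_apply] using congrArg (f j) (h (x i))

theorem hattoriStallings_range_le {R : Type u} [Ring R] {S : AddSubgroup (HHZero R)}
    (h : ∀ (n : ℕ) (E : Matrix (Fin n) (Fin n) R), E * E = E → HHZero.mk R E.trace ∈ S) :
    (hattoriStallings R).range ≤ S := by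
  have hP : ∀ c, hattoriStallingsClass R c ∈ S := by
    rintro ⟨P⟩
    obtain ⟨n, E, hE, hr⟩ := exists_idempotent_hattoriStallingsRank R P.carrier
    change hattoriStallingsRank R P.carrier ∈ S
    rw [hr]
    exact h n E hE
  rintro _ ⟨x, rfl⟩
  rw [hattoriStallings, Algebra.GrothendieckAddGroup.lift_apply]
  exact S.sub_mem (hP _) (hP _)

/-! ### `HH₀` of a group ring and transfer along `j` -/

/-- The sums of the coefficients of an element of the group ring over the conjugacy classes. -/
noncomputable def conjClassSum (G : Type u) [Group G] :
    MonoidAlgebra ℤ G →+ (ConjClasses G →₀ ℤ) :=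
  (Finsupp.mapDomain.addMonoidHom ConjClasses.mk).comp MonoidAlgebra.coeffAddEquiv.toAddMonoidHom

@[simp]
theorem conjClassSum_single {G : Type u} [Group G] (g : G) (r : ℤ) :
    conjClassSum G (MonoidAlgebra.single g r) = Finsupp.single (ConjClasses.mk g) r := by
  simp [conjClassSum]

theorem conjClassSum_mul_comm {G : Type u} [Group G] (a b : MonoidAlgebra ℤ G) :
    conjClassSum G (a * b) = conjClassSum G (b * a) := by
  induction a using MonoidAlgebra.induction_linear with
  | zero => simp
  | add a a' h h' => simp [add_mul, mul_add, h, h']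
  | single g r =>
    induction b using MonoidAlgebra.induction_linear with
    | zero => simp
    | add b b' h h' => simp [add_mul, mul_add, h, h']
    | single k s =>
      have : ConjClasses.mk (g * k) = ConjClasses.mk (k * g) :=
        ConjClasses.mk_eq_mk_iff_isConj.2 (isConj_iff.2 ⟨k, by group⟩)
      simp [MonoidAlgebra.single_mul_single, this, mul_comm]

theorem conjClassSum_eq_iff {G : Type u} [Group G] {a b : MonoidAlgebra ℤ G} :
    conjClassSum G a = conjClassSum G b ↔ HHZero.mk _ a = HHZero.mk _ b := by
  constructor
  -- Sending a class to the image of a chosen representative recovers the universal trace, as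
  -- conjugate group elements agree in `HH₀`.
  · let σ : (ConjClasses G →₀ ℤ) →+ HHZero (MonoidAlgebra ℤ G) := Finsupp.liftAddHom fun c =>
      (HHZero.mk _).comp (MonoidAlgebra.singleAddHom (Quotient.out c))
    have hσ : σ.comp (conjClassSum G) = HHZero.mk _ := by
      refine MonoidAlgebra.addMonoidHom_ext fun g r => ?_
      have hout : IsConj (Quotient.out (ConjClasses.mk g)) g :=
        Quotient.mk_out (s := IsConj.setoid G) g
      obtain ⟨c, hc⟩ := isConj_iff.1 hout
      have h := HHZero.mk_mul_comm (MonoidAlgebra.single c 1)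
        (MonoidAlgebra.single (Quotient.out (ConjClasses.mk g) * c⁻¹) r)
      simp only [MonoidAlgebra.single_mul_single, one_mul, mul_one, inv_mul_cancel_right,
        ← mul_assoc, hc] at h
      simp [σ, h]
    intro h
    rw [← hσ, AddMonoidHom.comp_apply, h, AddMonoidHom.comp_apply]
  · intro h
    rw [← sub_eq_zero, ← map_sub] at h ⊢
    have hle : ringCommutator (MonoidAlgebra ℤ G) ≤ (conjClassSum G).ker :=
      (AddSubgroup.closure_le _).2 (by
        rintro _ ⟨a, b, rfl⟩
        simp [AddMonoidHom.mem_ker, conjClassSum_mul_comm a b])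
    exact hle ((QuotientAddGroup.eq_zero_iff _).1 h)

theorem BassTraceConjecture.of_isConj_reflecting {G B : Type u} [Group G] [Group B] (j : G →* B)
    (hj : ∀ x y, IsConj (j x) (j y) → IsConj x y) (hB : BassTraceConjecture B) :
    BassTraceConjecture G := by
  refine hattoriStallings_range_le fun n E hE => ?_
  let F := MonoidAlgebra.mapDomainRingHom ℤ j
  have hinj : Function.Injective (ConjClasses.map j) := by
    rintro ⟨x⟩ ⟨y⟩ h
    exact ConjClasses.mk_eq_mk_iff_isConj.2 (hj x y (ConjClasses.mk_eq_mk_iff_isConj.1 h))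
  have hF : ∀ a, conjClassSum B (F a) = (conjClassSum G a).mapDomain (ConjClasses.map j) := by
    intro a
    induction a using MonoidAlgebra.induction_linear with
    | zero => simp
    | add a b ha hb => simp [Finsupp.mapDomain_add, ha, hb]
    | single g r => simp [F, Finsupp.mapDomain_single]; rfl
  obtain ⟨k, hk⟩ := hB (hattoriStallings_idempotent (E.map F) (by rw [← Matrix.map_mul, hE]))
  refine ⟨k, ?_⟩
  have htr : (E.map F).trace = F E.trace := (AddMonoidHom.map_trace F E).symm
  -- The multiple of `[e]` found over `ℤB` comes from the same multiple over `ℤG`, so the two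
  -- classes can be compared there.
  have hone : F (k • MonoidAlgebra.of ℤ G 1) = k • MonoidAlgebra.of ℤ B 1 := by simp [F]
  simp only [← map_zsmul] at hk ⊢
  rw [htr, ← hone, ← conjClassSum_eq_iff, hF, hF] at hk
  exact conjClassSum_eq_iff.1 (Finsupp.mapDomain_injective hinj hk)

theorem corollary4p3 :
    (∀ (G : Type u) [Group G], BassTraceConjecture G) ↔
      (∀ (G : Type u) [Group G], IsBinate G → BassTraceConjecture G) := by
  refine ⟨fun h G _ _ => h G, fun h G _ => ?_⟩
  obtain ⟨B, j, hB, hj⟩ := exists_isBinate_isConj_reflecting G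
  exact .of_isConj_reflecting j hj (h B hB)
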